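/- Let $\mathcal A$ be an abelian category. An object $H\neq 0$ of $\mathcal A$ is \emph{monoform} if there are no subobjects $0\neq L'\subsetneq L\subset H$ and $0\neq N\subset H$ with $L/L'\cong N$. Two monoform objects are \emph{atom-equivalent} if they have isomorphic nonzero subobjects; this is an equivalence relation, the class of $H$ is denoted by $\overline H$, and the set of classes (called \emph{atoms}) is the atom spectrum $\operatorname{ASpec}\mathcal A$. It carries the topology with open basis $\{\operatorname{ASupp}M\mid M\in\mathcal A\}$, where $\operatorname{ASupp}M=\{\overline H\mid H\text{ is a monoform subquotient of }M\}$. For each atom fix a monoform object representing it. Let $\alpha,\beta$ be atoms with fixed representatives $H$ and $K$, and let $i\geq 0$ be an integer. For $N\in\mathcal A$ put $\operatorname{Ext}^i(\alpha,N)=\varinjlim_{0\neq H'\subset H}\operatorname{Ext}^i_{\mathcal A}(H',N)$, the direct limit over all nonzero subobjects of $H$, and let $k(\alpha)=\varinjlim_{0\neq H'\subset H}\operatorname{Hom}_{\mathcal A}(H',H)$. Composition makes $k(\alpha)$ a skew field and $\operatorname{Ext}^i(\alpha,N)$ a right $k(\alpha)$-module, functorially in $N$. Put $D_\alpha=\operatorname{Hom}_{k(\alpha)}(-,k(\alpha))$,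 $$\operatorname{Ext}^i(\alpha,\beta)=\varprojlim_{0\neq K'\subset K}\operatorname{Ext}^i(\alpha,K'),\qquad V^i(\alpha,\beta)=\varinjlim_{0\neq K'\subset K}D_\alpha\operatorname{Ext}^i(\alpha,K').$$ The pair $(\alpha,\beta)$ is \emph{eventually constant} (resp. \emph{eventually epic}) in degree $i$ if there is a nonzero subobject $K'\subset K$ such that for all nonzero subobjects $K_2\subset K_1\subset K'$ the canonical map $\operatorname{Ext}^i(\alpha,K_2)\to\operatorname{Ext}^i(\alpha,K_1)$ is bijective (resp. surjective). Define $$\operatorname{Epi}_i(\alpha)=\{\beta\mid(\alpha,\beta)\text{ is eventually epic in degree }i\text{ and }V^i(\alpha,\beta)\neq 0\},$$ $$\operatorname{Const}_i(\alpha)=\{\beta\mid(\alpha,\beta)\text{ is eventually constant in degree }i\text{ and }\operatorname{Ext}^i(\alpha,\beta)\neq 0\}.$$ For a subset $S$ of a topological space let $L(S)$ be the set of points $x$ belonging to the closure of $S\setminus\{x\}$, and let $L^0(S)=S$, $L^{j}(S)=L(L^{j-1}(S))$ for $j\geq 1$. \textbf{Theorem.} Assume that $\mathcal A$ admits a (small)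 generating set consisting of noetherian objects, that is, a small family $(U_s)$ of noetherian objects such that for every nonzero morphism $f\colon X\to Y$ there are an index $s$ and a morphism $g\colon U_s\to X$ with $fg\neq 0$. Let $\alpha\in\operatorname{ASpec}\mathcal A$. Then: 1. $\operatorname{Epi}_0(\alpha)=\operatorname{Const}_0(\alpha)=\{\alpha\}$. 2. For every integer $i\geq 1$, $\operatorname{Epi}_i(\alpha)\subset\operatorname{Const}_i(\alpha)\cup L(\operatorname{Epi}_{i-1}(\alpha))$. 3. For every integer $i\geq 0$, $\operatorname{Epi}_i(\alpha)\subset\bigcup_{j=0}^{i}L^j(\operatorname{Const}_{i-j}(\alpha))$. -/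

import Mathlib

open CategoryTheory CategoryTheory.Limits Opposite

universe w v u

noncomputable section

namespace AtomTheory

section Monoform

variable {C : Type u} [Category.{v} C] [Abelian C]

/-- A monoform object: a nonzero object `H` for which there are no subobjects
`0 ≠ L' ⊊ L ⊆ H` and `0 ≠ N ⊆ H` with `L / L' ≅ N`. -/
def IsMonoform (H : C) : Prop :=
  ¬ IsZero H ∧ ∀ (L' L : Subobject H) (h : L' < L), L' ≠ ⊥ →
    ∀ N : Subobject H, N ≠ ⊥ → IsEmpty (cokernel (Subobject.ofLE L' L h.le) ≅ (N : C))

/-- `X` is a subquotient of `M`: a quotient object of a subobject of `M`. -/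
def IsSubquotient (X M : C) : Prop :=
  ∃ (L : Subobject M) (p : (L : C) ⟶ X), Epi p

/-- A family of objects, indexed by a small type, is generating if every nonzero morphism
`f : X ⟶ Y` stays nonzero after composition with some morphism from a member of the family. -/
def IsGeneratingSet {ι : Type v} (U : ι → C) : Prop :=
  ∀ ⦃X Y : C⦄ (f : X ⟶ Y), f ≠ 0 → ∃ (i : ι) (g : U i ⟶ X), g ≫ f ≠ 0

variable (C) in
/-- The monoform objects of `C`. -/
structure MonoformObj where
  /-- the underlying object -/
  obj : C
  /-- it is monoform -/
  isMonoform : IsMonoform obj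

theorem eq_bot_of_arrow_eq_zero {X : C} {S : Subobject X} (h : S.arrow = 0) : S = ⊥ := by
  rw [← Subobject.mk_arrow S]
  exact Subobject.mk_eq_bot_iff_zero.2 h

theorem arrow_ne_zero {X : C} {S : Subobject X} (h : S ≠ ⊥) : S.arrow ≠ 0 :=
  fun h' => h (eq_bot_of_arrow_eq_zero h')

/-- A morphism that factors through two subobjects with zero intersection is zero. -/
theorem eq_zero_of_factors {X Z : C} {S T : Subobject X} (h : S ⊓ T = ⊥) (g : Z ⟶ X)
    (hS : S.Factors g) (hT : T.Factors g) : g = 0 := by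
  have h2 : (S ⊓ T).Factors g := (Subobject.inf_factors g).2 ⟨hS, hT⟩
  rw [h] at h2
  exact (Subobject.bot_factors_iff_zero _).1 h2

/-- If `S ⊓ T = ⊥` then `(S ⊔ T) / T ≅ S`. -/
theorem nonempty_cokernel_iso {X : C} {S T : Subobject X} (h : S ⊓ T = ⊥) :
    Nonempty (cokernel (Subobject.ofLE T (S ⊔ T) le_sup_right) ≅ (S : C)) := by
  let t := Subobject.ofLE T (S ⊔ T) le_sup_right
  let s := Subobject.ofLE S (S ⊔ T) le_sup_left
  let φ := s ≫ cokernel.π t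
  have hmono : Mono φ := by
    refine Preadditive.mono_of_cancel_zero _ fun {Z} g hg => ?_
    have hg' : (g ≫ s) ≫ cokernel.π t = 0 := by simpa [φ] using hg
    let l := Abelian.monoLift t (g ≫ s) hg'
    have hl : l ≫ t = g ≫ s := Abelian.monoLift_comp _ _ _
    have : g ≫ S.arrow = 0 := by
      refine eq_zero_of_factors h _ (Subobject.factors_of_le _ le_rfl ?_) ?_
      · exact (Subobject.factors_iff _ _).2 ⟨g, rfl⟩
      · refine (Subobject.factors_iff _ _).2 ⟨l, ?_⟩
        change l ≫ T.arrow = g ≫ S.arrow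
        have := congrArg (· ≫ (S ⊔ T).arrow) hl
        simpa [s, t] using this
    exact (cancel_mono S.arrow).1 (by simpa using this)
  have hepi : Epi φ := by
    refine Preadditive.epi_of_cancel_zero _ fun {Z} g hg => ?_
    let m := cokernel.π t ≫ g
    have hs : s ≫ m = 0 := by simpa [φ, m] using hg
    have ht : t ≫ m = 0 := by simp [m]
    have hle : S ⊔ T ≤ Subobject.mk (kernel.ι m ≫ (S ⊔ T).arrow) := by
      refine sup_le ?_ ?_
      · refine Subobject.le_mk_of_comm (kernel.lift m s hs) ?_
        simp [s]
      · refine Subobject.le_mk_of_comm (kernel.lift m t ht) ?_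
        simp [t]
    have h1 : Subobject.ofLEMk _ _ hle ≫ kernel.ι m = 𝟙 _ := by
      rw [← cancel_mono (S ⊔ T).arrow, Category.assoc, Subobject.ofLEMk_comp, Category.id_comp]
    have hm : m = 0 := by
      rw [← Category.id_comp m, ← h1, Category.assoc, kernel.condition, comp_zero]
    exact (cancel_epi (cokernel.π t)).1 (by simpa [m] using hm)
  have := isIso_of_mono_of_epi φ
  exact ⟨(asIso φ).symm⟩

/-- A monoform object is uniform. -/
theorem IsMonoform.inf_ne_bot {H : C} (hH : IsMonoform H) {S T : Subobject H}
    (hS : S ≠ ⊥) (hT : T ≠ ⊥) : S ⊓ T ≠ ⊥ := by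
  intro h
  have hlt : T < S ⊔ T := by
    refine lt_of_le_of_ne le_sup_right fun he => hS ?_
    have : S ≤ T := he ▸ le_sup_left
    rwa [inf_eq_left.2 this] at h
  obtain ⟨e⟩ := nonempty_cokernel_iso h
  exact (hH.2 T (S ⊔ T) hlt hT S hS).false e

/-- Atom-equivalence of monoform objects: they have isomorphic nonzero subobjects. -/
def AtomEquiv (H₁ H₂ : MonoformObj C) : Prop :=
  ∃ (L₁ : Subobject H₁.obj) (L₂ : Subobject H₂.obj),
    L₁ ≠ ⊥ ∧ L₂ ≠ ⊥ ∧ Nonempty ((L₁ : C) ≅ (L₂ : C))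

theorem atomEquiv_equivalence : Equivalence (AtomEquiv (C := C)) where
  refl H := by
    have : (⊤ : Subobject H.obj) ≠ ⊥ := by
      intro h
      refine H.isMonoform.1 ((IsZero.iff_id_eq_zero _).2 ?_)
      have := Subobject.mk_eq_bot_iff_zero.1 ((Subobject.top_eq_id H.obj).symm.trans h)
      exact this
    exact ⟨⊤, ⊤, this, this, ⟨Iso.refl _⟩⟩
  symm := fun ⟨L₁, L₂, h₁, h₂, ⟨e⟩⟩ => ⟨L₂, L₁, h₂, h₁, ⟨e.symm⟩⟩
  trans := by
    rintro H₁ H₂ H₃ ⟨L₁, L₂, h₁, h₂, ⟨e⟩⟩ ⟨M₂, M₃, k₂, k₃, ⟨e'⟩⟩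
    have hne := H₂.isMonoform.inf_ne_bot h₂ k₂
    let a := Subobject.ofLE (L₂ ⊓ M₂) L₂ inf_le_left ≫ e.inv ≫ L₁.arrow
    let b := Subobject.ofLE (L₂ ⊓ M₂) M₂ inf_le_right ≫ e'.hom ≫ M₃.arrow
    have hid : 𝟙 ((L₂ ⊓ M₂ : Subobject H₂.obj) : C) ≠ 0 := by
      intro h
      exact arrow_ne_zero hne (by rw [← Category.id_comp (L₂ ⊓ M₂).arrow, h, zero_comp])
    have key : ∀ {Y : C} (f : ((L₂ ⊓ M₂ : Subobject H₂.obj) : C) ⟶ Y) [Mono f],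
        Subobject.mk f ≠ ⊥ := by
      intro Y f _ h
      have h0 := Subobject.mk_eq_bot_iff_zero.1 h
      exact hid ((cancel_mono f).1 (by simp [h0]))
    exact ⟨Subobject.mk a, Subobject.mk b, key a, key b,
      ⟨Subobject.underlyingIso a ≪≫ (Subobject.underlyingIso b).symm⟩⟩

variable (C) in
/-- The setoid of monoform objects modulo atom-equivalence. -/
def atomSetoid : Setoid (MonoformObj C) := ⟨AtomEquiv, atomEquiv_equivalence⟩

variable (C) in
/-- The atom spectrum: monoform objects modulo atom-equivalence. -/
def AtomSpectrum : Type u := Quotient (atomSetoid C)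

/-- The atom represented by a monoform object. -/
def MonoformObj.atom (H : MonoformObj C) : AtomSpectrum C := Quotient.mk (atomSetoid C) H

/-- The atom support of an object. -/
def ASupp (M : C) : Set (AtomSpectrum C) :=
  {α | ∃ H : MonoformObj C, H.atom = α ∧ IsSubquotient H.obj M}

/-- The localizing topology, with basis the atom supports of all objects. -/
instance : TopologicalSpace (AtomSpectrum C) :=
  TopologicalSpace.generateFrom (Set.range (ASupp (C := C)))

end Monoform

section Colim

variable {C : Type u} [Category.{v} C] [Abelian C]

/-- The nonzero subobjects of a monoform object, ordered by reverse inclusion. -/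
structure NonzeroSub (H : MonoformObj C) : Type (max u v) where
  /-- the underlying subobject -/
  sub : Subobject H.obj
  /-- it is nonzero -/
  ne_bot : sub ≠ ⊥

instance (H : MonoformObj C) : Preorder (NonzeroSub H) where
  le S T := T.sub ≤ S.sub
  le_refl S := le_refl S.1
  le_trans _ _ _ h h' := le_trans h' h

instance (H : MonoformObj C) : IsDirectedOrder (NonzeroSub H) where
  directed S T := ⟨⟨S.sub ⊓ T.sub, H.isMonoform.inf_ne_bot S.ne_bot T.ne_bot⟩, inf_le_left (a := S.sub),
    inf_le_right (b := T.sub)⟩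

/-- The monoform object as a nonzero subobject of itself. -/
def NonzeroSub.top (H : MonoformObj C) : NonzeroSub H :=
  ⟨⊤, fun h => H.isMonoform.1 ((IsZero.iff_id_eq_zero _).2
    (Subobject.mk_eq_bot_iff_zero.1 ((Subobject.top_eq_id H.obj).symm.trans h)))⟩

instance (H : MonoformObj C) : Nonempty (NonzeroSub H) := ⟨NonzeroSub.top H⟩

/-- The underlying object of a nonzero subobject. -/
abbrev NonzeroSub.toObj {H : MonoformObj C} (S : NonzeroSub H) : C := (S.sub : C)

/-- The inclusion `T ⊆ S` as a morphism. -/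
abbrev NonzeroSub.incl {H : MonoformObj C} {S T : NonzeroSub H} (h : S ≤ T) :
    T.toObj ⟶ S.toObj := Subobject.ofLE T.sub S.sub h

/-- The structure maps of the direct system `F(H')`, `0 ≠ H' ⊆ H`. -/
def sysMap (H : MonoformObj C) (F : Cᵒᵖ ⥤ AddCommGrpCat.{w}) (S T : NonzeroSub H) (h : S ≤ T) :
    F.obj (op S.toObj) →+ F.obj (op T.toObj) :=
  (F.map (NonzeroSub.incl h).op).hom

instance (H : MonoformObj C) (F : Cᵒᵖ ⥤ AddCommGrpCat.{w}) :
    DirectedSystem (fun S : NonzeroSub H => F.obj (op S.toObj)) (sysMap H F · · ·) where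
  map_self S x := by
    simp [sysMap]
  map_map W T S h h' x := by
    have : NonzeroSub.incl h' ≫ NonzeroSub.incl h = NonzeroSub.incl (h.trans h') :=
      Subobject.ofLE_comp_ofLE _ _ _ _ _
    simp only [sysMap, ← this, op_comp, F.map_comp]
    rfl

/-- For a contravariant functor `F` to abelian groups, the direct limit of `F(H')` over all
nonzero subobjects `H'` of the monoform object `H`. -/
def AtomColim (H : MonoformObj C) (F : Cᵒᵖ ⥤ AddCommGrpCat.{w}) : Type (max u v w) :=
  DirectLimit (fun S : NonzeroSub H => F.obj (op S.toObj)) (sysMap H F)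

instance (H : MonoformObj C) (F : Cᵒᵖ ⥤ AddCommGrpCat.{w}) : AddCommGroup (AtomColim H F) :=
  inferInstanceAs (AddCommGroup
    (DirectLimit (fun S : NonzeroSub H => F.obj (op S.toObj)) (sysMap H F)))

namespace AtomColim

variable {H : MonoformObj C} {F G : Cᵒᵖ ⥤ AddCommGrpCat.{w}}

/-- The class in the direct limit of an element of `F(S)`. -/
def mk (S : NonzeroSub H) (x : F.obj (op S.toObj)) : AtomColim H F :=
  Quotient.mk (DirectLimit.setoid (sysMap H F)) ⟨S, x⟩

theorem mk_eq_mk {S T : NonzeroSub H} {x : F.obj (op S.toObj)} {y : F.obj (op T.toObj)}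
    (W : NonzeroSub H) (hS : S ≤ W) (hT : T ≤ W)
    (h : F.map (NonzeroSub.incl hS).op x = F.map (NonzeroSub.incl hT).op y) :
    mk S x = mk (F := F) T y :=
  Quotient.sound ⟨W, hS, hT, h⟩

theorem mk_res {S T : NonzeroSub H} (h : S ≤ T) (x : F.obj (op S.toObj)) :
    mk T (F.map (NonzeroSub.incl h).op x) = mk (F := F) S x :=
  DirectLimit.mk_apply (F := fun S : NonzeroSub H => F.obj (op S.toObj)) (f := sysMap H F) S T x h

theorem exists_mk (x : AtomColim H F) : ∃ (S : NonzeroSub H) (y : F.obj (op S.toObj)),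
    x = mk S y :=
  DirectLimit.exists_eq_mk _ x

theorem exists_mk₂ (x y : AtomColim H F) : ∃ (S : NonzeroSub H) (a b : F.obj (op S.toObj)),
    x = mk S a ∧ y = mk S b :=
  DirectLimit.exists_eq_mk₂ _ x y

theorem mk_add (S : NonzeroSub H) (x y : F.obj (op S.toObj)) :
    mk S (x + y) = (mk S x + mk S y : AtomColim H F) :=
  (DirectLimit.add_def (G := fun S : NonzeroSub H => F.obj (op S.toObj)) (f := sysMap H F)
    S x y).symm

theorem mk_zero (S : NonzeroSub H) : mk S 0 = (0 : AtomColim H F) :=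
  (DirectLimit.zero_def (f := sysMap H F) S).symm

/-- The map of direct limits induced by a natural transformation. -/
def mapHom (H : MonoformObj C) (τ : F ⟶ G) : AtomColim H F →+ AtomColim H G :=
  AddMonoidHom.mk'
    (DirectLimit.map (sysMap H F) (sysMap H G) (fun S x => τ.app (op S.toObj) x)
      (fun S T h x => (ConcreteCategory.congr_hom (τ.naturality (NonzeroSub.incl h).op) x).symm))
    (by
      intro x y
      obtain ⟨S, a, b, rfl, rfl⟩ := exists_mk₂ x y
      rw [← mk_add]
      change mk S (τ.app (op S.toObj) (a + b)) =
        (mk S (τ.app (op S.toObj) a) + mk S (τ.app (op S.toObj) b) : AtomColim H G)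
      rw [map_add, mk_add])

theorem mapHom_mk (τ : F ⟶ G) (S : NonzeroSub H) (x : F.obj (op S.toObj)) :
    mapHom H τ (mk S x) = mk S (τ.app (op S.toObj) x) := rfl

end AtomColim

/-- The residue field `k(α) = Hom(α, H) = colim Hom(H', H)` of the atom represented by `H`,
the direct limit being over all nonzero subobjects `H'` of `H`. -/
def ResidueField (H : MonoformObj C) : Type (max u v) :=
  AtomColim H (preadditiveYoneda.obj H.obj)

instance (H : MonoformObj C) : AddCommGroup (ResidueField H) :=
  inferInstanceAs (AddCommGroup (AtomColim H (preadditiveYoneda.obj H.obj)))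

/-- The class in `k(α)` of a morphism `f : S ⟶ H` from a nonzero subobject `S` of `H`. -/
def ResidueField.mk {H : MonoformObj C} (S : NonzeroSub H) (f : S.toObj ⟶ H.obj) :
    ResidueField H :=
  AtomColim.mk (F := preadditiveYoneda.obj H.obj) S f

/-- The preimage `f⁻¹(T) ⊆ S ⊆ H` of a nonzero subobject `T` of `H` under `f : S ⟶ H`. -/
def preim {H : MonoformObj C} (S : NonzeroSub H) (f : S.toObj ⟶ H.obj) (T : NonzeroSub H) :
    NonzeroSub H :=
  ⟨Subobject.mk (pullback.fst f T.sub.arrow ≫ S.sub.arrow), by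
    intro h
    have h1 := Subobject.mk_eq_bot_iff_zero.1 h
    have h2 : pullback.fst f T.sub.arrow = 0 := (cancel_mono S.sub.arrow).1 (by simpa using h1)
    have hf : Mono f := by
      refine Preadditive.mono_of_cancel_zero _ fun {Z} g hg => ?_
      have := pullback.lift_fst (f := f) (g := T.sub.arrow) g 0 (by simpa using hg)
      rw [← this, h2, comp_zero]
    have hmk : Subobject.mk f ≠ ⊥ := by
      intro h3
      have h4 := Subobject.mk_eq_bot_iff_zero.1 h3
      apply arrow_ne_zero S.ne_bot
      have : 𝟙 S.toObj = 0 := (cancel_mono f).1 (by simp [h4])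
      rw [← Category.id_comp S.sub.arrow, this, zero_comp]
    have hI := H.isMonoform.inf_ne_bot hmk T.ne_bot
    apply arrow_ne_zero hI
    let a := Subobject.ofLEMk (Subobject.mk f ⊓ T.sub) f inf_le_left
    let b := Subobject.ofLE (Subobject.mk f ⊓ T.sub) T.sub inf_le_right
    have hab : a ≫ f = b ≫ T.sub.arrow := by simp [a, b]
    have ha : a = 0 := by
      rw [← pullback.lift_fst (f := f) (g := T.sub.arrow) a b hab, h2, comp_zero]
    have : a ≫ f = (Subobject.mk f ⊓ T.sub).arrow := Subobject.ofLEMk_comp _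
    rw [← this, ha, zero_comp]⟩

theorem le_preim {H : MonoformObj C} (S : NonzeroSub H) (f : S.toObj ⟶ H.obj)
    (T : NonzeroSub H) : S ≤ preim S f T :=
  Subobject.mk_le_of_comm (pullback.fst f T.sub.arrow) rfl

/-- The restriction `f⁻¹(T) ⟶ T` of `f : S ⟶ H`. -/
def preimHom {H : MonoformObj C} (S : NonzeroSub H) (f : S.toObj ⟶ H.obj) (T : NonzeroSub H) :
    (preim S f T).toObj ⟶ T.toObj :=
  Subobject.ofLEMk (preim S f T).sub (pullback.fst f T.sub.arrow ≫ S.sub.arrow) le_rfl ≫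
    pullback.snd f T.sub.arrow

theorem preimHom_arrow {H : MonoformObj C} (S : NonzeroSub H) (f : S.toObj ⟶ H.obj)
    (T : NonzeroSub H) :
    preimHom S f T ≫ T.sub.arrow = NonzeroSub.incl (le_preim S f T) ≫ f := by
  let a := Subobject.ofLEMk (preim S f T).sub (pullback.fst f T.sub.arrow ≫ S.sub.arrow) le_rfl
  have h : NonzeroSub.incl (le_preim S f T) = a ≫ pullback.fst f T.sub.arrow := by
    rw [← cancel_mono S.sub.arrow, Category.assoc]
    exact (Subobject.ofLE_arrow _).trans (Subobject.ofLEMk_comp _).symm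
  rw [h, preimHom, Category.assoc, Category.assoc, pullback.condition]

namespace AtomColim

variable {H : MonoformObj C} {F G : Cᵒᵖ ⥤ AddCommGrpCat.{w}}

theorem mk_map_eq {T W₁ W₂ V : NonzeroSub H} (x : F.obj (op T.toObj))
    (k₁ : W₁.toObj ⟶ T.toObj) (k₂ : W₂.toObj ⟶ T.toObj) (h₁ : W₁ ≤ V) (h₂ : W₂ ≤ V)
    (h : NonzeroSub.incl h₁ ≫ k₁ ≫ T.sub.arrow = NonzeroSub.incl h₂ ≫ k₂ ≫ T.sub.arrow) :
    mk W₁ (F.map k₁.op x) = mk (F := F) W₂ (F.map k₂.op x) := by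
  refine mk_eq_mk V h₁ h₂ ?_
  have hk : NonzeroSub.incl h₁ ≫ k₁ = NonzeroSub.incl h₂ ≫ k₂ := by
    rw [← cancel_mono T.sub.arrow, Category.assoc, Category.assoc, h]
  have := congrArg (fun l => F.map l.op x) hk
  simpa using this

/-- Two restrictions of `f : S ⟶ H` to morphisms into `T` give the same class. -/
theorem mk_map_eq' {S T W₁ W₂ : NonzeroSub H} (x : F.obj (op T.toObj)) (f : S.toObj ⟶ H.obj)
    (h₁ : S ≤ W₁) (h₂ : S ≤ W₂) (k₁ : W₁.toObj ⟶ T.toObj) (k₂ : W₂.toObj ⟶ T.toObj)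
    (e₁ : k₁ ≫ T.sub.arrow = NonzeroSub.incl h₁ ≫ f)
    (e₂ : k₂ ≫ T.sub.arrow = NonzeroSub.incl h₂ ≫ f) :
    mk W₁ (F.map k₁.op x) = mk (F := F) W₂ (F.map k₂.op x) := by
  obtain ⟨V, hV₁, hV₂⟩ := exists_ge_ge W₁ W₂
  refine mk_map_eq x k₁ k₂ hV₁ hV₂ ?_
  rw [e₁, e₂]
  simp [NonzeroSub.incl]

/-- The right action of `k(α)` on `colim F(H')`: the class of `x ∈ F(S)` times the class of
`f : S ⟶ H` is the class of the pullback of `x` along the restriction `f⁻¹(S) ⟶ S`. -/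
def act (x : AtomColim H F) (f : ResidueField H) : AtomColim H F :=
  DirectLimit.lift₂ (sysMap H F) (sysMap H (preadditiveYoneda.obj H.obj))
    (fun S x f => mk (preim S f S) (F.map (preimHom S f S).op x))
    (by
      intro S T h x f
      change S.toObj ⟶ H.obj at f
      let f' : T.toObj ⟶ H.obj := NonzeroSub.incl h ≫ f
      change mk (preim S f S) (F.map (preimHom S f S).op x) =
        mk (preim T f' T) (F.map (preimHom T f' T).op (F.map (NonzeroSub.incl h).op x))
      have h1 : F.map (preimHom T f' T).op (F.map (NonzeroSub.incl h).op x) =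
          F.map (preimHom T f' T ≫ NonzeroSub.incl h).op x := by simp
      rw [h1]
      refine mk_map_eq' x f (le_preim S f S) (h.trans (le_preim T f' T)) _ _
        (preimHom_arrow S f S) ?_
      have := preimHom_arrow T f' T
      simp only [NonzeroSub.incl, Category.assoc, Subobject.ofLE_arrow]
      rw [this]
      simp [f', NonzeroSub.incl])
    x f

theorem act_mk {S T W : NonzeroSub H} (x : F.obj (op T.toObj)) (f : S.toObj ⟶ H.obj)
    (h : S ≤ W) (k : W.toObj ⟶ T.toObj) (e : k ≫ T.sub.arrow = NonzeroSub.incl h ≫ f) :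
    act (mk T x) (ResidueField.mk S f) = mk (F := F) W (F.map k.op x) := by
  obtain ⟨V, hT, hS⟩ := exists_ge_ge T S
  let f' : V.toObj ⟶ H.obj := NonzeroSub.incl hS ≫ f
  have h0 : act (mk T x) (ResidueField.mk S f) = mk (F := F) (preim V f' V)
      (F.map (preimHom V f' V).op (F.map (NonzeroSub.incl hT).op x)) :=
    DirectLimit.lift₂_def₂ _ _ _ _ _ _ V hT hS
  have h1 : F.map (preimHom V f' V).op (F.map (NonzeroSub.incl hT).op x) =
      F.map (preimHom V f' V ≫ NonzeroSub.incl hT).op x := by simp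
  rw [h0, h1]
  refine mk_map_eq' x f (hS.trans (le_preim V f' V)) h _ _ ?_ e
  have := preimHom_arrow V f' V
  simp only [NonzeroSub.incl, Category.assoc, Subobject.ofLE_arrow]
  rw [this]
  simp [f', NonzeroSub.incl]

end AtomColim

namespace ResidueField

variable {H : MonoformObj C}

/-- Multiplication of `k(α)`, induced by composition: `[g] * [f] = [g ∘ f]`. -/
instance : Mul (ResidueField H) where
  mul g f := AtomColim.act (F := preadditiveYoneda.obj H.obj) g f

/-- The unit of `k(α)` is the class of the identity. -/
instance : One (ResidueField H) where
  one := mk (NonzeroSub.top H) (NonzeroSub.top H).sub.arrow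

theorem exists_mk (x : ResidueField H) : ∃ (S : NonzeroSub H) (f : S.toObj ⟶ H.obj), x = mk S f :=
  AtomColim.exists_mk (F := preadditiveYoneda.obj H.obj) x

theorem exists_mk₂ (x y : ResidueField H) :
    ∃ (S : NonzeroSub H) (f g : S.toObj ⟶ H.obj), x = mk S f ∧ y = mk S g :=
  AtomColim.exists_mk₂ (F := preadditiveYoneda.obj H.obj) x y

theorem mk_add (S : NonzeroSub H) (f g : S.toObj ⟶ H.obj) : mk S (f + g) = mk S f + mk S g :=
  AtomColim.mk_add (F := preadditiveYoneda.obj H.obj) S f g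

theorem mk_res {S T : NonzeroSub H} (h : S ≤ T) (f : S.toObj ⟶ H.obj) :
    mk T (NonzeroSub.incl h ≫ f) = mk S f :=
  AtomColim.mk_res (F := preadditiveYoneda.obj H.obj) h f

theorem mk_mul_mk {S T W : NonzeroSub H} (g : T.toObj ⟶ H.obj) (f : S.toObj ⟶ H.obj)
    (h : S ≤ W) (k : W.toObj ⟶ T.toObj) (e : k ≫ T.sub.arrow = NonzeroSub.incl h ≫ f) :
    mk T g * mk S f = mk W (k ≫ g) :=
  AtomColim.act_mk (F := preadditiveYoneda.obj H.obj) g f h k e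

end ResidueField

namespace AtomColim

variable {H : MonoformObj C} {F G : Cᵒᵖ ⥤ AddCommGrpCat.{w}}

theorem act_one (x : AtomColim H F) : act x 1 = x := by
  obtain ⟨T, x, rfl⟩ := exists_mk x
  have hT : NonzeroSub.top H ≤ T := le_top (a := T.sub)
  refine (act_mk x _ hT (𝟙 _) ?_).trans ?_
  · simp [NonzeroSub.incl]
  · simp

theorem act_mul (x : AtomColim H F) (g f : ResidueField H) :
    act x (g * f) = act (act x g) f := by
  obtain ⟨R, x, rfl⟩ := exists_mk x
  obtain ⟨T, g, rfl⟩ := ResidueField.exists_mk g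
  obtain ⟨S, f, rfl⟩ := ResidueField.exists_mk f
  let P := preim T g R
  have hP := preimHom_arrow T g R
  let Q := preim S f P
  have hQ := preimHom_arrow S f P
  rw [act_mk x g (le_preim T g R) (preimHom T g R) hP,
    act_mk _ f (le_preim S f P) (preimHom S f P) hQ,
    ResidueField.mk_mul_mk g f (le_preim S f P)
      (preimHom S f P ≫ NonzeroSub.incl (le_preim T g R))
      (by simpa [NonzeroSub.incl] using hQ),
    act_mk x _ (le_refl Q) (preimHom S f P ≫ preimHom T g R) (by
      simp only [Category.assoc, hP]
      simp [NonzeroSub.incl, Q, P])]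
  simp [P, Q]

theorem add_act (x y : AtomColim H F) (f : ResidueField H) :
    act (x + y) f = act x f + act y f := by
  obtain ⟨T, x, y, rfl, rfl⟩ := exists_mk₂ x y
  obtain ⟨S, f, rfl⟩ := ResidueField.exists_mk f
  have e := preimHom_arrow S f T
  rw [← mk_add, act_mk _ f (le_preim S f T) _ e, act_mk _ f (le_preim S f T) _ e,
    act_mk _ f (le_preim S f T) _ e, map_add, mk_add]

theorem act_add [F.Additive] (x : AtomColim H F) (f g : ResidueField H) :
    act x (f + g) = act x f + act x g := by
  obtain ⟨T, x, rfl⟩ := exists_mk x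
  obtain ⟨S, f, g, rfl, rfl⟩ := ResidueField.exists_mk₂ f g
  obtain ⟨V, h₁, h₂⟩ := exists_ge_ge (preim S f T) (preim S g T)
  have hS : S ≤ V := (le_preim S f T).trans h₁
  let k := NonzeroSub.incl h₁ ≫ preimHom S f T
  let l := NonzeroSub.incl h₂ ≫ preimHom S g T
  have hk : k ≫ T.sub.arrow = NonzeroSub.incl hS ≫ f := by
    simp only [k, Category.assoc, preimHom_arrow]
    simp [NonzeroSub.incl]
  have hl : l ≫ T.sub.arrow = NonzeroSub.incl hS ≫ g := by
    simp only [l, Category.assoc, preimHom_arrow]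
    simp [NonzeroSub.incl]
  rw [← ResidueField.mk_add, act_mk x f hS k hk, act_mk x g hS l hl,
    act_mk x (f + g) hS (k + l) (by rw [Preadditive.add_comp, hk, hl, Preadditive.comp_add]),
    ← mk_add, op_add, F.map_add]
  rfl

theorem mapHom_act (τ : F ⟶ G) (x : AtomColim H F) (f : ResidueField H) :
    mapHom H τ (act x f) = act (mapHom H τ x) f := by
  obtain ⟨T, x, rfl⟩ := exists_mk x
  obtain ⟨S, f, rfl⟩ := ResidueField.exists_mk f
  have e := preimHom_arrow S f T
  rw [act_mk x f (le_preim S f T) _ e, mapHom_mk, mapHom_mk, act_mk _ f (le_preim S f T) _ e]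
  exact congrArg _ (ConcreteCategory.congr_hom (τ.naturality (preimHom S f T).op) x)

end AtomColim

/-- `k(α)` as a ring. -/
instance (H : MonoformObj C) : Ring (ResidueField H) :=
  { (inferInstance : AddCommGroup (ResidueField H)),
    (inferInstance : Mul (ResidueField H)), (inferInstance : One (ResidueField H)) with
    left_distrib := fun x f g => AtomColim.act_add (F := preadditiveYoneda.obj H.obj) x f g
    right_distrib := fun x y f => AtomColim.add_act (F := preadditiveYoneda.obj H.obj) x y f
    zero_mul := fun f => by
      have := AtomColim.add_act (F := preadditiveYoneda.obj H.obj) 0 0 f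
      rw [add_zero] at this
      exact left_eq_add.1 this
    mul_zero := fun x => by
      have := AtomColim.act_add (F := preadditiveYoneda.obj H.obj) x (0 : ResidueField H) 0
      rw [add_zero] at this
      exact left_eq_add.1 this
    mul_assoc := fun x g f => (AtomColim.act_mul (F := preadditiveYoneda.obj H.obj) x g f).symm
    mul_one := fun x => AtomColim.act_one (F := preadditiveYoneda.obj H.obj) x
    one_mul := fun x => by
      obtain ⟨S, f, rfl⟩ := ResidueField.exists_mk x
      let T := NonzeroSub.top H
      exact (ResidueField.mk_mul_mk T.sub.arrow f (le_preim S f T) (preimHom S f T)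
        (preimHom_arrow S f T)).trans (by
          rw [preimHom_arrow, ResidueField.mk_res]) }

/-- The right `k(α)`-module structure on `colim F(H')`. -/
instance (H : MonoformObj C) (F : Cᵒᵖ ⥤ AddCommGrpCat.{w}) [F.Additive] :
    Module (ResidueField H)ᵐᵒᵖ (AtomColim H F) where
  smul f x := AtomColim.act x f.unop
  one_smul x := AtomColim.act_one x
  mul_smul f g x := AtomColim.act_mul x g.unop f.unop
  smul_zero f := by
    have := AtomColim.add_act (F := F) (0 : AtomColim H F) 0 f.unop
    rw [add_zero] at this
    exact left_eq_add.1 this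
  smul_add f x y := AtomColim.add_act x y f.unop
  add_smul f g x := AtomColim.act_add x f.unop g.unop
  zero_smul x := by
    have := AtomColim.act_add x (0 : ResidueField H) 0
    rw [add_zero] at this
    exact left_eq_add.1 this

/-- The `k(α)`-linear map induced by a natural transformation. -/
def AtomColim.mapLin (H : MonoformObj C) {F G : Cᵒᵖ ⥤ AddCommGrpCat.{w}} [F.Additive]
    [G.Additive] (τ : F ⟶ G) : AtomColim H F →ₗ[(ResidueField H)ᵐᵒᵖ] AtomColim H G where
  toFun := AtomColim.mapHom H τ
  map_add' := map_add _
  map_smul' f x := AtomColim.mapHom_act τ x f.unop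

end Colim

section Ext

open Abelian

variable {C : Type u} [Category.{v} C] [Abelian C] [HasExt.{w} C]

/-- The contravariant functor `Ext^i(-, N)`. -/
abbrev extTo (i : ℕ) (N : C) : Cᵒᵖ ⥤ AddCommGrpCat.{w} := (extFunctor i).flip.obj N

instance (i : ℕ) (N : C) : (extTo i N).Additive where
  map_add {X Y f g} := by
    refine AddCommGrpCat.hom_ext (AddMonoidHom.ext fun (x : Ext (unop X) N i) => ?_)
    change (Ext.mk₀ (f.unop + g.unop)).comp x (zero_add i) =
      (Ext.mk₀ f.unop).comp x (zero_add i) + (Ext.mk₀ g.unop).comp x (zero_add i)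
    rw [Ext.mk₀_add, Ext.add_comp]

/-- `Ext^i(α, N) = colim Ext^i(H', N)` over all nonzero subobjects `H'` of the representative `H`
of the atom `α`. -/
abbrev AtomExt (i : ℕ) (H : MonoformObj C) (N : C) : Type (max u v w) :=
  AtomColim H (extTo i N)

/-- The map `Ext^i(α, N) → Ext^i(α, N')` induced by `g : N ⟶ N'`. -/
def AtomExt.map (i : ℕ) (H : MonoformObj C) {N N' : C} (g : N ⟶ N') :
    AtomExt i H N →ₗ[(ResidueField H)ᵐᵒᵖ] AtomExt i H N' :=
  AtomColim.mapLin H ((extFunctor i).flip.map g)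

theorem AtomExt.map_id (i : ℕ) (H : MonoformObj C) (N : C) (x : AtomExt i H N) :
    AtomExt.map i H (𝟙 N) x = x := by
  obtain ⟨S, x, rfl⟩ := AtomColim.exists_mk x
  change AtomColim.mk S (((extFunctor i).flip.map (𝟙 N)).app (op S.toObj) x) = _
  rw [CategoryTheory.Functor.map_id]
  rfl

theorem AtomExt.map_comp (i : ℕ) (H : MonoformObj C) {N N' N'' : C} (g : N ⟶ N')
    (g' : N' ⟶ N'') (x : AtomExt i H N) :
    AtomExt.map i H (g ≫ g') x = AtomExt.map i H g' (AtomExt.map i H g x) := by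
  obtain ⟨S, x, rfl⟩ := AtomColim.exists_mk x
  change AtomColim.mk S (((extFunctor i).flip.map (g ≫ g')).app (op S.toObj) x) = _
  rw [CategoryTheory.Functor.map_comp]
  rfl

/-- The dual `D_α Ext^i(α, N) = Hom_{k(α)}(Ext^i(α, N), k(α))` (homomorphisms of right
`k(α)`-modules). -/
abbrev DualExt (i : ℕ) (H : MonoformObj C) (N : C) : Type (max u v w) :=
  AtomExt i H N →ₗ[(ResidueField H)ᵐᵒᵖ] ResidueField H

/-- The structure maps of the direct system `D_α Ext^i(α, K')`, `0 ≠ K' ⊆ K`. -/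
def dualSysMap (i : ℕ) (H K : MonoformObj C) (S T : NonzeroSub K) (h : S ≤ T) :
    DualExt i H S.toObj →+ DualExt i H T.toObj :=
  AddMonoidHom.mk' (fun φ => φ.comp (AtomExt.map i H (NonzeroSub.incl h)))
    (fun _ _ => rfl)

instance (i : ℕ) (H K : MonoformObj C) :
    DirectedSystem (fun S : NonzeroSub K => DualExt i H S.toObj) (dualSysMap i H K · · ·) where
  map_self S φ := by
    have : NonzeroSub.incl (le_refl S) = 𝟙 _ := Subobject.ofLE_refl _
    ext x
    change φ (AtomExt.map i H (NonzeroSub.incl (le_refl S)) x) = φ x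
    rw [this, AtomExt.map_id]
  map_map W T S h h' φ := by
    have : NonzeroSub.incl h' ≫ NonzeroSub.incl h = NonzeroSub.incl (h.trans h') :=
      Subobject.ofLE_comp_ofLE _ _ _ _ _
    ext x
    change φ (AtomExt.map i H (NonzeroSub.incl h) (AtomExt.map i H (NonzeroSub.incl h') x)) =
      φ (AtomExt.map i H (NonzeroSub.incl (h.trans h')) x)
    rw [← this, AtomExt.map_comp]

/-- The virtual dual of `Ext^i(α, β)`: the direct limit of `D_α Ext^i(α, K')` over all nonzero
subobjects `K'` of `K`, where `H` and `K` represent `α` and `β`. -/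
abbrev VirtualDual (i : ℕ) (H K : MonoformObj C) : Type (max u v w) :=
  DirectLimit (fun S : NonzeroSub K => DualExt i H S.toObj) (dualSysMap i H K)

/-- `Ext^i(α, β)`: the inverse limit of `Ext^i(α, K')` over all nonzero subobjects `K'` of `K`,
where `H` and `K` represent `α` and `β`. -/
def AtomAtomExt (i : ℕ) (H K : MonoformObj C) :
    AddSubgroup (∀ S : NonzeroSub K, AtomExt i H S.toObj) where
  carrier := {x | ∀ (S T : NonzeroSub K) (h : S ≤ T),
    AtomExt.map i H (NonzeroSub.incl h) (x T) = x S}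
  add_mem' {x y} hx hy S T h := by simp [hx S T h, hy S T h]
  zero_mem' S T h := by simp
  neg_mem' {x} hx S T h := by simp [hx S T h]

/-- Eventually constant: for some nonzero `K' ⊆ K`, all maps `Ext^i(α, K₂) → Ext^i(α, K₁)` with
`0 ≠ K₂ ⊆ K₁ ⊆ K'` are bijective. (`S ≤ T` in `NonzeroSub K` means that `T ⊆ S`.) -/
def EventuallyConstant (i : ℕ) (H K : MonoformObj C) : Prop :=
  ∃ K' : NonzeroSub K, ∀ (K₁ K₂ : NonzeroSub K) (_ : K' ≤ K₁) (h : K₁ ≤ K₂),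
    Function.Bijective (AtomExt.map i H (NonzeroSub.incl h))

/-- Eventually epic: for some nonzero `K' ⊆ K`, all maps `Ext^i(α, K₂) → Ext^i(α, K₁)` with
`0 ≠ K₂ ⊆ K₁ ⊆ K'` are surjective. -/
def EventuallyEpic (i : ℕ) (H K : MonoformObj C) : Prop :=
  ∃ K' : NonzeroSub K, ∀ (K₁ K₂ : NonzeroSub K) (_ : K' ≤ K₁) (h : K₁ ≤ K₂),
    Function.Surjective (AtomExt.map i H (NonzeroSub.incl h))

/-- `Epi_i(α)`, where `rep` gives the fixed representatives of the atoms. -/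
def EpiSet (rep : AtomSpectrum C → MonoformObj C) (i : ℕ) (α : AtomSpectrum C) :
    Set (AtomSpectrum C) :=
  {β | EventuallyEpic i (rep α) (rep β) ∧ Nontrivial (VirtualDual i (rep α) (rep β))}

/-- `Const_i(α)`, where `rep` gives the fixed representatives of the atoms. -/
def ConstSet (rep : AtomSpectrum C → MonoformObj C) (i : ℕ) (α : AtomSpectrum C) :
    Set (AtomSpectrum C) :=
  {β | EventuallyConstant i (rep α) (rep β) ∧ Nontrivial (AtomAtomExt i (rep α) (rep β))}

end Ext

end AtomTheory

end

noncomputable section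

namespace AtomTheory

/-! ### Subquotients of noetherian objects -/

section Noetherian

variable {C : Type u} [Category.{v} C] [Abelian C]

/-! The engine is `exists_mem_EpiSet`: nonvanishing of `Ext^i(α, X)` for noetherian `X` is detected
by an atom of `Epi_i(α)` in the support of `X`. Among the subquotients of `X` with nonzero `Ext^i(α,
-)`, take `Y` with maximal kernel in `X`. Quotients of subobjects of `Y` by nonzero subobjects then
have zero `Ext^i(α, -)`, so every inclusion of nonzero subobjects of `Y` is surjective on `Ext^i(α,
-)`. A monoform subobject of `Y` yields the atom.

For the recursion, let `β` be in `Epi_{i+1}(α)` but not a limit point of `Epi_i(α)`. Some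
neighbourhood of `β` meets `Epi_i(α)` at most in `β`, and a noetherian `K' ⊆ K` has its support
there. For `K₂ ⊆ K₁ ⊆ K'`, if `Ext^i(α, K₁/K₂)` were nonzero, the engine would put `β` itself in the
support of `K₁/K₂`, which `atom_notMem_ASupp_cokernel` forbids since `K` is monoform. So this group
vanishes, and the long exact sequence upgrades surjectivity in degree `i + 1` to bijectivity.

Degree 0 reflects that morphisms out of an atom are, up to restriction, zero or mono. The last
inclusion iterates the recursion, since derived sets commute with finite unions. -/

theorem subobject_mk_ne_bot {X Y : C} (f : X ⟶ Y) [Mono f] (hX : ¬ IsZero X) :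
    Subobject.mk f ≠ ⊥ := by
  intro h
  have h0 := Subobject.mk_eq_bot_iff_zero.1 h
  exact hX ((IsZero.iff_id_eq_zero _).2 ((cancel_mono f).1 (by simp [h0])))

theorem NonzeroSub.not_isZero {H : MonoformObj C} (S : NonzeroSub H) : ¬ IsZero S.toObj :=
  fun h => arrow_ne_zero S.ne_bot (h.eq_of_src _ _)

/-- Among the subquotients of a noetherian object having a given property, there is one none of
whose proper subquotients (by a nonzero kernel) has the property. -/
theorem exists_minimal_subquotient {X : C} [IsNoetherianObject X] (P : C → Prop)
    {L₀ Y₀ : C} (m₀ : L₀ ⟶ X) [Mono m₀] (p₀ : L₀ ⟶ Y₀) [Epi p₀] (h₀ : P Y₀) :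
    ∃ (L Y : C) (m : L ⟶ X) (p : L ⟶ Y), Mono m ∧ Epi p ∧ P Y ∧
      ∀ (W Q : C) (j : W ⟶ Y) (q : W ⟶ Q), Mono j → Epi q → P Q → Mono q := by
  -- A subquotient is recorded by its kernel, viewed as a subobject of `X`; a maximal kernel gives a
  -- minimal subquotient.
  let T : Set (Subobject X) := {M | ∃ (L Y : C) (m : L ⟶ X) (p : L ⟶ Y) (_ : Mono m),
    Epi p ∧ P Y ∧ M = Subobject.mk (kernel.ι p ≫ m)}
  have hT : T.Nonempty := ⟨_, L₀, Y₀, m₀, p₀, inferInstance, inferInstance, h₀, rfl⟩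
  obtain ⟨M, ⟨L, Y, m, p, hm, hp, hY, rfl⟩, hmax⟩ :=
    (wellFounded_gt (α := Subobject X)).has_min T hT
  refine ⟨L, Y, m, p, hm, hp, hY, fun W Q j q hj hq hQ => ?_⟩
  -- Through the preimage of `W` in `L`, `Q` is again a subquotient of `X`, and its kernel contains
  -- that of `p`. Maximality makes the two kernels equal.
  let r := pullback.snd p j ≫ q
  let m' := pullback.fst p j ≫ m
  have hle : Subobject.mk (kernel.ι p ≫ m) ≤ Subobject.mk (kernel.ι r ≫ m') := by
    refine Subobject.mk_le_mk_of_comm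
      (kernel.lift r (pullback.lift (kernel.ι p) 0 (by simp)) (by
        rw [pullback.lift_snd_assoc, zero_comp])) ?_
    rw [kernel.lift_ι_assoc, pullback.lift_fst_assoc]
  have hge : Subobject.mk (kernel.ι r ≫ m') ≤ Subobject.mk (kernel.ι p ≫ m) := by
    by_contra hn
    exact hmax _ ⟨_, Q, m', r, inferInstance, inferInstance, hQ, rfl⟩ (lt_of_le_not_ge hle hn)
  have hker : kernel.ι r ≫ pullback.fst p j ≫ p = 0 := by
    have : Subobject.ofMkLEMk _ _ hge ≫ kernel.ι p = kernel.ι r ≫ pullback.fst p j := by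
      rw [← cancel_mono m]
      simp [m']
    rw [← Category.assoc, ← this, Category.assoc, kernel.condition, comp_zero]
  refine Preadditive.mono_of_cancel_zero _ fun {Z} g hg => ?_
  -- `g` lifts to the preimage of `W` only after an epimorphic cover of `Z`.
  let a : pullback g (pullback.snd p j) ⟶ kernel r :=
    kernel.lift r (pullback.snd _ _) (by
      rw [← Category.assoc, ← pullback.condition, Category.assoc, hg, comp_zero])
  have ha : a ≫ kernel.ι r = pullback.snd g (pullback.snd p j) := kernel.lift_ι _ _ _
  rw [← cancel_epi (pullback.fst g (pullback.snd p j)), comp_zero, pullback.condition,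
    ← cancel_mono j, zero_comp, Category.assoc, ← pullback.condition, ← ha, Category.assoc, hker,
    comp_zero]

/-- A nonzero subquotient of a noetherian object has a monoform subobject. -/
theorem exists_monoform_of_noetherian {X L Y : C} [IsNoetherianObject X] (m : L ⟶ X) [Mono m]
    (p : L ⟶ Y) [Epi p] (hY : ¬ IsZero Y) :
    ∃ (G : MonoformObj C) (j : G.obj ⟶ Y), Mono j := by
  -- The property is hereditary in the right sense: if `L / L'` embeds in `G`, it is nonzero and
  -- embeds in `Y`, so minimality of `G` forces `L' = 0`.
  obtain ⟨L', G, m', p', -, -, ⟨hG, j, hj⟩, h⟩ := exists_minimal_subquotient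
    (fun Z => ¬ IsZero Z ∧ ∃ j : Z ⟶ Y, Mono j) m p ⟨hY, 𝟙 Y, inferInstance⟩
  refine ⟨⟨G, hG, fun L' L hlt hL' N hN => ⟨fun e => hL' ?_⟩⟩, j, hj⟩
  have hN0 : ¬ IsZero (N : C) := fun h0 => arrow_ne_zero hN (h0.eq_of_src _ _)
  have := h _ _ L.arrow (cokernel.π (Subobject.ofLE L' L hlt.le)) inferInstance inferInstance
    ⟨fun h0 => hN0 (h0.of_iso e.symm), e.hom ≫ N.arrow ≫ j, inferInstance⟩
  have h0 : Subobject.ofLE L' L hlt.le = 0 :=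
    (cancel_mono (cokernel.π (Subobject.ofLE L' L hlt.le))).1 (by simp)
  apply eq_bot_of_arrow_eq_zero
  rw [← Subobject.ofLE_arrow hlt.le, h0, zero_comp]

/-- Since `p⁻¹(S) ⟶ S` is epi, `S` is recovered from `p⁻¹(S)`; strict chains in `Y` therefore pull
back to strict chains in `X`. -/
theorem IsNoetherianObject.of_epi {X Y : C} (p : X ⟶ Y) [Epi p] [IsNoetherianObject X] :
    IsNoetherianObject Y := by
  rw [isNoetherianObject_iff_not_strictMono]
  intro f hf
  have hinj : Function.Injective (Subobject.pullback p).obj := by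
    have key : ∀ S T : Subobject Y,
        (Subobject.pullback p).obj S = (Subobject.pullback p).obj T → S ≤ T := by
      intro S T h
      have hp := Subobject.isPullback p T
      have hS := Subobject.isPullback p S
      have hle := h.le
      have hepi : Epi (Subobject.pullbackπ p S) := by
        have := hS.isoPullback_hom_fst
        rw [← this]; infer_instance
      have hz : S.arrow ≫ cokernel.π T.arrow = 0 := by
        rw [← cancel_epi (Subobject.pullbackπ p S), ← Category.assoc, hS.w,
          ← Subobject.ofLE_arrow hle, Category.assoc, Category.assoc, ← Category.assoc _ p,
          ← hp.w]
        simp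
      exact Subobject.le_of_comm (Abelian.monoLift T.arrow S.arrow hz)
        (Abelian.monoLift_comp _ _ _)
    exact fun S T h => le_antisymm (key S T h) (key T S h.symm)
  exact not_strictMono_of_isNoetherianObject _
    ((((Subobject.pullback p).monotone).strictMono_of_injective hinj).comp hf)

/-- With a generating set of noetherian objects, every nonzero object has a nonzero noetherian
subobject. -/
theorem exists_noetherian_mono {ι : Type v} {U : ι → C} (hU : IsGeneratingSet U)
    (hN : ∀ i, IsNoetherianObject (U i)) {X : C} (hX : ¬ IsZero X) :
    ∃ (Y : C) (m : Y ⟶ X), Mono m ∧ IsNoetherianObject Y ∧ ¬ IsZero Y := by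
  obtain ⟨i, g, hg⟩ := hU (𝟙 X) fun h => hX ((IsZero.iff_id_eq_zero _).2 h)
  have := hN i
  refine ⟨Abelian.image g, Abelian.image.ι g, inferInstance,
    IsNoetherianObject.of_epi (Abelian.factorThruImage g), fun h0 => hg ?_⟩
  rw [Category.comp_id, ← Abelian.image.fac g, h0.eq_of_src (Abelian.image.ι g) 0, comp_zero]

end Noetherian

/-! ### Atom supports and neighbourhoods of an atom -/

section Support

theorem IsSubquotient.of_mono_of_epi {C : Type u} [Category.{v} C] {L X M : C} (m : L ⟶ M) [Mono m]
    (p : L ⟶ X) [Epi p] :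
    IsSubquotient X M :=
  ⟨Subobject.mk m, (Subobject.underlyingIso m).hom ≫ p, inferInstance⟩

theorem IsSubquotient.of_mono {C : Type u} [Category.{v} C] {X Y : C} (m : X ⟶ Y) [Mono m] :
    IsSubquotient X Y :=
  IsSubquotient.of_mono_of_epi m (𝟙 X)

variable {C : Type u} [Category.{v} C] [Abelian C]

theorem IsSubquotient.trans {X Y Z : C} (h : IsSubquotient X Y) (h' : IsSubquotient Y Z) :
    IsSubquotient X Z := by
  obtain ⟨L, p, hp⟩ := h
  obtain ⟨M, q, hq⟩ := h'
  exact IsSubquotient.of_mono_of_epi (pullback.fst q L.arrow ≫ M.arrow)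
    (pullback.snd q L.arrow ≫ p)

theorem ASupp_subset {X Y : C} (h : IsSubquotient X Y) : ASupp X ⊆ ASupp Y :=
  fun _ ⟨G, hG, hs⟩ => ⟨G, hG, hs.trans h⟩

theorem atom_eq_iff {G K : MonoformObj C} : G.atom = K.atom ↔ AtomEquiv G K :=
  Quotient.eq (r := atomSetoid C)

/-- Monoform objects with a common nonzero subobject are atom-equivalent. -/
theorem atom_eq_of_mono {G K : MonoformObj C} {Z : C} (hZ : ¬ IsZero Z) (a : Z ⟶ G.obj)
    (b : Z ⟶ K.obj) [Mono a] [Mono b] : G.atom = K.atom :=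
  atom_eq_iff.2 ⟨Subobject.mk a, Subobject.mk b, subobject_mk_ne_bot a hZ,
    subobject_mk_ne_bot b hZ, ⟨Subobject.underlyingIso a ≪≫ (Subobject.underlyingIso b).symm⟩⟩

/-- A nonzero quotient of a subobject of a monoform object `K` which embeds into `K` is a quotient
by zero. -/
theorem IsMonoform.mono_of_epi {K W Z : C} (hK : IsMonoform K) (m : W ⟶ K) [Mono m] (r : W ⟶ Z)
    [Epi r] (hZ : ¬ IsZero Z) (n : Z ⟶ K) [Mono n] : Mono r := by
  refine Preadditive.mono_of_kernel_zero ?_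
  by_contra hr
  have hle : Subobject.mk (kernel.ι r ≫ m) ≤ Subobject.mk m := Subobject.mk_le_mk_of_comm _ rfl
  have hne : Subobject.mk (kernel.ι r ≫ m) ≠ ⊥ := by
    refine subobject_mk_ne_bot _ fun h0 => hr (h0.eq_of_src _ _)
  let e : cokernel (Subobject.ofLE _ _ hle) ≅ Z :=
    cokernel.mapIso (Subobject.ofLE _ _ hle) (kernel.ι r) (Subobject.underlyingIso _)
      (Subobject.underlyingIso _) (by
        rw [← cancel_mono m]
        simp) ≪≫ (cokernelIsCokernel (kernel.ι r)).coconePointUniqueUpToIso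
          (Abelian.epiIsCokernelOfKernel _ (limit.isLimit _))
  -- Equality would split `kernel.ι r`, making `r` both zero and epi, so `Z = 0`.
  have hlt : Subobject.mk (kernel.ι r ≫ m) < Subobject.mk m := by
    refine lt_of_le_of_ne hle fun h => hZ ?_
    have ha : Subobject.ofMkLEMk _ _ h.ge ≫ kernel.ι r = 𝟙 W := by
      rw [← cancel_mono m]
      simp
    have hr0 : r = 0 := by
      rw [← Category.id_comp r, ← ha, Category.assoc, kernel.condition, comp_zero]
    exact (IsZero.iff_id_eq_zero _).2 ((cancel_epi r).1 (by simp [hr0]))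
  exact (hK.2 _ _ hlt hne (Subobject.mk n) (subobject_mk_ne_bot n hZ)).false
    (e ≪≫ (Subobject.underlyingIso n).symm)

/-- The atom of a monoform object is not in the support of the proper quotients of its
subobjects. -/
theorem atom_notMem_ASupp_cokernel {K : MonoformObj C} {X₁ X₂ : C} (i : X₂ ⟶ X₁) [Mono i]
    (m : X₁ ⟶ K.obj) [Mono m] (h : ¬ IsZero X₂) : K.atom ∉ ASupp (cokernel i) := by
  rintro ⟨G, hG, hs⟩
  obtain ⟨L₁, L₂, h₁, -, ⟨e⟩⟩ := atom_eq_iff.1 hG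
  obtain ⟨W, q, hq⟩ := (IsSubquotient.of_mono L₁.arrow).trans hs
  have hL₁ : ¬ IsZero (L₁ : C) := fun h0 => arrow_ne_zero h₁ (h0.eq_of_src _ _)
  -- The preimage of `W` in `X₁` maps onto `L₁ ≅ L₂ ⊆ K`, so this map is mono; yet it kills `X₂`,
  -- which lies in that preimage.
  have := K.isMonoform.mono_of_epi (pullback.fst (cokernel.π i) W.arrow ≫ m)
    (pullback.snd (cokernel.π i) W.arrow ≫ q) hL₁ (e.hom ≫ L₂.arrow)
  have h0 : pullback.lift (f := cokernel.π i) (g := W.arrow) i 0 (by simp) = 0 := by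
    rw [← cancel_mono (pullback.snd (cokernel.π i) W.arrow ≫ q), pullback.lift_snd_assoc]
    simp
  have hi : i = 0 := by
    rw [← pullback.lift_fst (f := cokernel.π i) (g := W.arrow) i 0 (by simp), h0, zero_comp]
  exact h ((IsZero.iff_id_eq_zero _).2 ((cancel_mono i).1 (by simp [hi])))

/-- The supports of the nonzero subobjects of `K` form a neighbourhood basis of its atom. -/
theorem exists_ASupp_subset_of_mem_open {K : MonoformObj C} {V : Set (AtomSpectrum C)}
    (hV : IsOpen V) (hK : K.atom ∈ V) : ∃ S : NonzeroSub K, ASupp S.toObj ⊆ V := by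
  induction hV with
  | basic s hs =>
    obtain ⟨M, rfl⟩ := hs
    obtain ⟨G, hG, hs⟩ := hK
    obtain ⟨L₁, L₂, -, h₂, ⟨e⟩⟩ := atom_eq_iff.1 hG
    exact ⟨⟨L₂, h₂⟩, ASupp_subset ((IsSubquotient.of_mono (e.inv ≫ L₁.arrow)).trans hs)⟩
  | univ => exact ⟨NonzeroSub.top K, Set.subset_univ _⟩
  | inter s t _ _ ihs iht =>
    obtain ⟨S, hS⟩ := ihs hK.1
    obtain ⟨T, hT⟩ := iht hK.2
    obtain ⟨W, hSW, hTW⟩ := exists_ge_ge S T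
    exact ⟨W, Set.subset_inter
      ((ASupp_subset (IsSubquotient.of_mono (NonzeroSub.incl hSW))).trans hS)
      ((ASupp_subset (IsSubquotient.of_mono (NonzeroSub.incl hTW))).trans hT)⟩
  | sUnion s _ ih =>
    obtain ⟨t, ht, hKt⟩ := hK
    obtain ⟨S, hS⟩ := ih t ht hKt
    exact ⟨S, hS.trans (Set.subset_sUnion_of_mem ht)⟩

end Support

/-! ### The residue field is a skew field -/

section ResidueField

variable {C : Type u} [Category.{v} C] [Abelian C]

theorem AtomColim.mk_eq_zero_iff {H : MonoformObj C} {F : Cᵒᵖ ⥤ AddCommGrpCat.{w}}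
    {S : NonzeroSub H} {x : F.obj (op S.toObj)} :
    (mk S x : AtomColim H F) = 0 ↔
      ∃ (W : NonzeroSub H) (h : S ≤ W), F.map (NonzeroSub.incl h).op x = 0 := by
  constructor
  · intro h
    rw [← mk_zero S] at h
    obtain ⟨W, h₁, h₂, e⟩ := Quotient.exact (s := DirectLimit.setoid (sysMap H F)) h
    refine ⟨W, h₁, e.trans (map_zero (sysMap H F S W h₂))⟩
  · rintro ⟨W, h, e⟩
    rw [← mk_res h x, e, mk_zero]

/-- A morphism from a nonzero subobject which is not a monomorphism restricts to zero on some
nonzero subobject. -/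
theorem NonzeroSub.exists_incl_comp_eq_zero {H : MonoformObj C} (S : NonzeroSub H) {Y : C}
    (f : S.toObj ⟶ Y) (hf : ¬ Mono f) :
    ∃ (W : NonzeroSub H) (h : S ≤ W), NonzeroSub.incl h ≫ f = 0 := by
  refine ⟨⟨Subobject.mk (kernel.ι f ≫ S.sub.arrow), subobject_mk_ne_bot _ fun h0 =>
    hf (Preadditive.mono_of_kernel_zero (h0.eq_of_src _ _))⟩,
    Subobject.mk_le_of_comm (kernel.ι f) rfl, ?_⟩
  have hle : Subobject.mk (kernel.ι f ≫ S.sub.arrow) ≤ S.sub :=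
    Subobject.mk_le_of_comm (kernel.ι f) rfl
  have h : Subobject.ofLE _ _ hle =
      (Subobject.underlyingIso (kernel.ι f ≫ S.sub.arrow)).hom ≫ kernel.ι f := by
    rw [← cancel_mono S.sub.arrow]
    simp
  change Subobject.ofLE _ _ hle ≫ f = 0
  rw [h, Category.assoc, kernel.condition, comp_zero]

theorem ResidueField.mk_eq_zero_iff {H : MonoformObj C} {S : NonzeroSub H}
    {f : S.toObj ⟶ H.obj} :
    mk S f = 0 ↔ ∃ (W : NonzeroSub H) (h : S ≤ W), NonzeroSub.incl h ≫ f = 0 :=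
  AtomColim.mk_eq_zero_iff (F := preadditiveYoneda.obj H.obj)

theorem ResidueField.mono_of_mk_ne_zero {H : MonoformObj C} {S : NonzeroSub H}
    {f : S.toObj ⟶ H.obj} (h : mk S f ≠ 0) : Mono f := by
  by_contra hf
  exact h (mk_eq_zero_iff.2 (S.exists_incl_comp_eq_zero f hf))

instance (H : MonoformObj C) : Nontrivial (ResidueField H) := by
  refine ⟨1, 0, fun h => ?_⟩
  obtain ⟨W, hW, e⟩ := ResidueField.mk_eq_zero_iff.1 h
  rw [NonzeroSub.incl, Subobject.ofLE_arrow] at e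
  exact arrow_ne_zero W.ne_bot e

/-- A nonzero class is represented by a monomorphism `S ⟶ H`; its inverse on the image, a nonzero
subobject of `H`, is the left inverse. -/
theorem ResidueField.exists_mul_eq_one {H : MonoformObj C} {f : ResidueField H} (hf : f ≠ 0) :
    ∃ g, g * f = 1 := by
  obtain ⟨S, f, rfl⟩ := exists_mk f
  have := mono_of_mk_ne_zero hf
  let T : NonzeroSub H := ⟨Subobject.mk f, subobject_mk_ne_bot f S.not_isZero⟩
  let e : S.toObj ≅ T.toObj := (Subobject.underlyingIso f).symm
  refine ⟨mk T (e.inv ≫ S.sub.arrow), ?_⟩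
  rw [mk_mul_mk _ f (le_refl S) e.hom (by simp [e, T, NonzeroSub.incl])]
  have hT : NonzeroSub.top H ≤ S := le_top (a := S.sub)
  rw [Iso.hom_inv_id_assoc, ← Subobject.ofLE_arrow hT]
  exact mk_res hT _

instance (H : MonoformObj C) : DivisionRing (ResidueField H) :=
  DivisionRing.ofIsUnitOrEqZero fun f => by
    by_cases hf : f = 0
    · exact Or.inr hf
    · obtain ⟨g, hg⟩ := ResidueField.exists_mul_eq_one hf
      have hg0 : g ≠ 0 := by
        rintro rfl
        exact zero_ne_one ((zero_mul f).symm.trans hg)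
      obtain ⟨k, hk⟩ := ResidueField.exists_mul_eq_one hg0
      -- Left inverses suffice: `k * g = 1` and `g * f = 1` give `k = f`, so `g` is two-sided.
      have hkf : k = f := by
        rw [← mul_one k, ← hg, ← mul_assoc, hk, one_mul]
      exact Or.inl ⟨⟨f, g, hkf ▸ hk, hg⟩, rfl⟩

/-- A nonzero right vector space over `k(α)` has a nonzero functional. -/
theorem exists_functional_ne_zero (H : MonoformObj C) (E : Type*) [AddCommGroup E]
    [Module (ResidueField H)ᵐᵒᵖ E] [Nontrivial E] :
    ∃ φ : E →ₗ[(ResidueField H)ᵐᵒᵖ] ResidueField H, φ ≠ 0 := by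
  obtain ⟨x, hx⟩ := exists_ne (0 : E)
  obtain ⟨f, hf⟩ : ∃ f : Module.Dual (ResidueField H)ᵐᵒᵖ E, f x ≠ 0 := by
    by_contra! h
    exact hx ((Module.forall_dual_apply_eq_zero_iff (ResidueField H)ᵐᵒᵖ x).1 h)
  -- `Module.Dual` takes values in the opposite ring; acting on `1` carries them linearly into
  -- `k(α)` as a right module.
  refine ⟨(LinearMap.toSpanSingleton (ResidueField H)ᵐᵒᵖ (ResidueField H) 1).comp f, fun h => hf ?_⟩
  have := LinearMap.congr_fun h x
  simpa using this

end ResidueField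

/-! ### Exactness of Ext out of an atom -/

section Ext

open Abelian

variable {C : Type u} [Category.{v} C] [Abelian C] [HasExt.{w} C]

namespace AtomExt

variable {i : ℕ} {H : MonoformObj C}

/-- The class in `Ext^i(α, N)` of an extension class on a nonzero subobject. -/
def mk {N : C} (S : NonzeroSub H) (x : Ext S.toObj N i) : AtomExt i H N :=
  AtomColim.mk (F := extTo i N) S x

theorem exists_mk {N : C} (x : AtomExt i H N) :
    ∃ (S : NonzeroSub H) (y : Ext S.toObj N i), x = mk S y :=
  AtomColim.exists_mk x

theorem map_mk {N N' : C} (g : N ⟶ N') (S : NonzeroSub H) (x : Ext S.toObj N i) :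
    map i H g (mk S x) = mk S (x.comp (Ext.mk₀ g) (add_zero i)) := rfl

theorem mk_res {N : C} {S W : NonzeroSub H} (h : S ≤ W) (x : Ext S.toObj N i) :
    mk W ((Ext.mk₀ (NonzeroSub.incl h)).comp x (zero_add i)) = mk S x :=
  AtomColim.mk_res (F := extTo i N) h x

theorem mk_eq_zero_iff {N : C} {S : NonzeroSub H} {x : Ext S.toObj N i} :
    mk S x = 0 ↔ ∃ (W : NonzeroSub H) (h : S ≤ W),
      (Ext.mk₀ (NonzeroSub.incl h)).comp x (zero_add i) = 0 :=
  AtomColim.mk_eq_zero_iff (F := extTo i N)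

theorem mk_zero {N : C} (S : NonzeroSub H) : mk S (0 : Ext S.toObj N i) = 0 :=
  AtomColim.mk_zero (F := extTo i N) S

/-- Vanishing in the direct limit already occurs on some nonzero `W ⊆ H`, where the long exact
sequence for `Ext(W, -)` applies. -/
theorem map_surjective_of_shortExact {S : ShortComplex C} (hS : S.ShortExact)
    (h : Subsingleton (AtomExt i H S.X₃)) : Function.Surjective (map i H S.f) := by
  intro x
  obtain ⟨T, x, rfl⟩ := exists_mk x
  obtain ⟨W, hW, e⟩ := mk_eq_zero_iff.1
    (Subsingleton.elim (mk T (x.comp (Ext.mk₀ S.g) (add_zero i))) 0)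
  rw [← Ext.comp_assoc _ _ _ (zero_add i) (add_zero i) (by simp)] at e
  obtain ⟨y, hy⟩ := Ext.covariant_sequence_exact₂ _ hS _ e
  exact ⟨mk W y, by rw [map_mk, hy, mk_res]⟩

/-- On some `W` the class is the image of `y ∈ Ext^i(W, X₃)` under the connecting map, whence the
degree shift; `y` dies on a smaller `V`. -/
theorem map_injective_of_shortExact {S : ShortComplex C} (hS : S.ShortExact)
    (h : Subsingleton (AtomExt i H S.X₃)) : Function.Injective (map (i + 1) H S.f) := by
  refine (injective_iff_map_eq_zero _).2 fun x hx => ?_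
  obtain ⟨T, x, rfl⟩ := exists_mk x
  rw [map_mk] at hx
  obtain ⟨W, hW, e⟩ := mk_eq_zero_iff.1 hx
  rw [← Ext.comp_assoc _ _ _ (zero_add _) (add_zero _) (by simp)] at e
  obtain ⟨y, hy⟩ := Ext.covariant_sequence_exact₁ _ hS _ e rfl
  obtain ⟨V, hV, e'⟩ := mk_eq_zero_iff.1 (Subsingleton.elim (mk W y) 0)
  rw [← mk_res hW, ← mk_res hV, ← hy, ← Ext.comp_assoc _ _ _ (zero_add _) rfl (by simp), e',
    Ext.zero_comp, mk_zero]

theorem map_surjective_of_mono {X Y : C} (f : X ⟶ Y) [Mono f]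
    (h : Subsingleton (AtomExt i H (cokernel f))) : Function.Surjective (map i H f) :=
  map_surjective_of_shortExact (S := ShortComplex.mk f (cokernel.π f) (by simp))
    { exact := ShortComplex.exact_cokernel f } h

theorem map_injective_of_mono {X Y : C} (f : X ⟶ Y) [Mono f]
    (h : Subsingleton (AtomExt i H (cokernel f))) : Function.Injective (map (i + 1) H f) :=
  map_injective_of_shortExact (S := ShortComplex.mk f (cokernel.π f) (by simp))
    { exact := ShortComplex.exact_cokernel f } h

theorem map_zero_injective {X Y : C} (f : X ⟶ Y) [Mono f] :
    Function.Injective (map 0 H f) := by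
  refine (injective_iff_map_eq_zero _).2 fun x hx => ?_
  obtain ⟨T, x, rfl⟩ := exists_mk x
  rw [map_mk] at hx
  obtain ⟨W, hW, e⟩ := mk_eq_zero_iff.1 hx
  rw [← Ext.comp_assoc _ _ _ (zero_add _) (add_zero _) (by simp)] at e
  refine mk_eq_zero_iff.2 ⟨W, hW, Ext.postcomp_mk₀_injective_of_mono _ f ?_⟩
  exact e.trans (map_zero ((Ext.mk₀ f).postcomp _ (add_zero 0))).symm

/-- A nonzero element of `Ext^0(α, N)` is represented by a monomorphism. -/
theorem exists_mono_of_nontrivial {N : C} (h : Nontrivial (AtomExt 0 H N)) :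
    ∃ (S : NonzeroSub H) (f : S.toObj ⟶ N), Mono f := by
  obtain ⟨x, hx⟩ := exists_ne (0 : AtomExt 0 H N)
  obtain ⟨S, x, rfl⟩ := exists_mk x
  obtain ⟨f, rfl⟩ := (Ext.mk₀_bijective _ _).2 x
  refine ⟨S, f, ?_⟩
  by_contra hf
  obtain ⟨W, hW, e⟩ := S.exists_incl_comp_eq_zero f hf
  exact hx (mk_eq_zero_iff.2 ⟨W, hW, by rw [Ext.mk₀_comp_mk₀, e, Ext.mk₀_zero]⟩)

theorem nontrivial_zero_sub (S : NonzeroSub H) : Nontrivial (AtomExt 0 H S.toObj) := by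
  refine ⟨mk S (Ext.mk₀ (𝟙 _)), 0, fun h => ?_⟩
  obtain ⟨W, hW, e⟩ := mk_eq_zero_iff.1 h
  rw [Ext.mk₀_comp_mk₀, Ext.mk₀_eq_zero_iff, Category.comp_id] at e
  apply arrow_ne_zero W.ne_bot
  rw [← Subobject.ofLE_arrow hW]
  exact (congrArg (· ≫ S.sub.arrow) e).trans zero_comp

/-- A morphism into `S` restricts to one into `T` on the preimage of `T`, which is nonzero because
`H` is uniform. -/
theorem map_zero_surjective {S T : NonzeroSub H} (h : S ≤ T) :
    Function.Surjective (map 0 H (NonzeroSub.incl h)) := by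
  intro x
  obtain ⟨R, x, rfl⟩ := exists_mk x
  obtain ⟨f, rfl⟩ := (Ext.mk₀_bijective _ _).2 x
  let f' := f ≫ S.sub.arrow
  refine ⟨mk (preim R f' T) (Ext.mk₀ (preimHom R f' T)), ?_⟩
  rw [map_mk, ← mk_res (le_preim R f' T), Ext.mk₀_comp_mk₀, Ext.mk₀_comp_mk₀]
  congr 2
  rw [← cancel_mono S.sub.arrow, Category.assoc, NonzeroSub.incl, Subobject.ofLE_arrow,
    preimHom_arrow, Category.assoc]

end AtomExt

/-! ### Nonvanishing of the virtual dual and of the inverse limit -/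

section Limits

variable {i : ℕ} {H K : MonoformObj C}

theorem AtomExt.map_incl_trans {S T W : NonzeroSub K} (h : S ≤ T) (h' : T ≤ W)
    (x : AtomExt i H W.toObj) :
    map i H (NonzeroSub.incl h) (map i H (NonzeroSub.incl h') x) =
      map i H (NonzeroSub.incl (h.trans h')) x := by
  have : NonzeroSub.incl h' ≫ NonzeroSub.incl h = NonzeroSub.incl (h.trans h') :=
    Subobject.ofLE_comp_ofLE _ _ _ _ _
  rw [← map_comp, this]

/-- Used to find a nonzero `Ext^i(α, S)` inside any prescribed `T`: otherwise the dual system would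
vanish on a cofinal part. -/
theorem exists_nontrivial_of_virtualDual (h : Nontrivial (VirtualDual i H K)) (T : NonzeroSub K) :
    ∃ S : NonzeroSub K, T ≤ S ∧ Nontrivial (AtomExt i H S.toObj) := by
  by_contra! hn
  refine not_subsingleton (VirtualDual i H K) ⟨fun x y => ?_⟩
  obtain ⟨A, φ, ψ, rfl, rfl⟩ := DirectLimit.exists_eq_mk₂ _ x y
  obtain ⟨W, hA, hT⟩ := exists_ge_ge A T
  have := hn W hT
  exact Quotient.sound ⟨W, hA, hA, LinearMap.ext fun x => by
    rw [Subsingleton.elim x 0, _root_.map_zero, _root_.map_zero]⟩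

/-- Surjections dualise to injections, so a nonzero functional at `T` survives in the direct limit.
-/
theorem virtualDual_nontrivial (T : NonzeroSub K) [Nontrivial (AtomExt i H T.toObj)]
    (h : ∀ (S : NonzeroSub K) (hS : T ≤ S),
      Function.Surjective (AtomExt.map i H (NonzeroSub.incl hS))) :
    Nontrivial (VirtualDual i H K) := by
  obtain ⟨φ, hφ⟩ := exists_functional_ne_zero H (AtomExt i H T.toObj)
  refine ⟨Quotient.mk _ ⟨T, φ⟩, Quotient.mk _ ⟨T, 0⟩, fun e => hφ ?_⟩
  obtain ⟨W, hW, _, e'⟩ := Quotient.exact e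
  refine LinearMap.ext fun x => ?_
  obtain ⟨y, rfl⟩ := h W hW x
  exact LinearMap.congr_fun e' y

theorem nontrivial_of_atomAtomExt (h : Nontrivial (AtomAtomExt i H K)) :
    ∃ S : NonzeroSub K, Nontrivial (AtomExt i H S.toObj) := by
  by_contra! hn
  refine not_subsingleton (AtomAtomExt i H K) ⟨fun x y => Subtype.ext (funext fun S => ?_)⟩
  have := hn S
  exact Subsingleton.elim _ _

theorem atomAtomExt_nontrivial (T : NonzeroSub K) [Nontrivial (AtomExt i H T.toObj)]
    (h : ∀ (S S' : NonzeroSub K) (_ : T ≤ S) (hS : S ≤ S'),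
      Function.Bijective (AtomExt.map i H (NonzeroSub.incl hS))) :
    Nontrivial (AtomAtomExt i H K) := by
  obtain ⟨x, hx⟩ := exists_ne (0 : AtomExt i H T.toObj)
  -- The compatible family through `x` must also be defined at `S` not contained in `T`: lift `x` to
  -- some `W` inside both, then push forward to `S`. Two lifts are compared in a common smaller `V`,
  -- using bijectivity inside `T`.
  have hdef : ∀ S : NonzeroSub K, ∃ z : AtomExt i H S.toObj,
      ∀ (W : NonzeroSub K) (hS : S ≤ W) (hT : T ≤ W) (y : AtomExt i H W.toObj),
        AtomExt.map i H (NonzeroSub.incl hT) y = x →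
          AtomExt.map i H (NonzeroSub.incl hS) y = z := by
    intro S
    obtain ⟨W, hS, hT⟩ := exists_ge_ge S T
    obtain ⟨y, hy⟩ := (h T W le_rfl hT).2 x
    refine ⟨AtomExt.map i H (NonzeroSub.incl hS) y, fun W' hS' hT' y' hy' => ?_⟩
    obtain ⟨V, hV, hV'⟩ := exists_ge_ge W W'
    obtain ⟨a, rfl⟩ := (h W V hT hV).2 y
    obtain ⟨b, rfl⟩ := (h W' V hT' hV').2 y'
    rw [AtomExt.map_incl_trans] at hy hy'
    obtain rfl := (h T V le_rfl _).1 (hy.trans hy'.symm)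
    rw [AtomExt.map_incl_trans, AtomExt.map_incl_trans]
  choose z hz using hdef
  refine ⟨⟨z, fun S S' hS => ?_⟩, 0, fun e => hx ?_⟩
  · obtain ⟨W, hS', hT⟩ := exists_ge_ge S' T
    obtain ⟨y, hy⟩ := (h T W le_rfl hT).2 x
    rw [← hz S' W hS' hT y hy, AtomExt.map_incl_trans, hz S W _ hT y hy]
  · have h1 : AtomExt.map i H (NonzeroSub.incl (le_refl T)) x = x := by
      rw [show NonzeroSub.incl (le_refl T) = 𝟙 _ from Subobject.ofLE_refl _, AtomExt.map_id]
    have h2 := hz T T le_rfl le_rfl x h1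
    rw [h1] at h2
    rw [h2]
    exact congrFun (congrArg Subtype.val e) T

end Limits

/-! ### The sets `EpiSet` and `ConstSet` -/

section Main

variable {rep : AtomSpectrum C → MonoformObj C} {α : AtomSpectrum C} {i : ℕ}

/-- If `Ext^i(α, X) ≠ 0` for a noetherian object `X`, then some atom in the support of `X` lies in
`Epi_i(α)`. -/
theorem exists_mem_EpiSet (hrep : ∀ α, (rep α).atom = α) {X : C} [IsNoetherianObject X]
    (h : Nontrivial (AtomExt i (rep α) X)) : ∃ γ ∈ EpiSet rep i α, γ ∈ ASupp X := by
  obtain ⟨L, Y, m, p, hm, hp, hY, hmin⟩ := exists_minimal_subquotient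
    (fun Y => Nontrivial (AtomExt i (rep α) Y)) (𝟙 X) (𝟙 X) h
  -- The obstruction is `Ext^i(α, W/Z)`; `W/Z` is a quotient of a subobject of `Y` by a nonzero
  -- kernel, so minimality kills it.
  have hsurj : ∀ {Z W : C} (f : Z ⟶ W) (j : W ⟶ Y) [Mono f] [Mono j], ¬ IsZero Z →
      Function.Surjective (AtomExt.map i (rep α) f) := by
    intro Z W f j _ _ hZ
    refine AtomExt.map_surjective_of_mono f (not_nontrivial_iff_subsingleton.1 fun hn => hZ ?_)
    have := hmin W (cokernel f) j (cokernel.π f) inferInstance inferInstance hn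
    have hf : f = 0 := (cancel_mono (cokernel.π f)).1 (by simp)
    exact (IsZero.iff_id_eq_zero _).2 ((cancel_mono f).1 (by simp [hf]))
  have hY0 : ¬ IsZero Y := by
    intro h0
    have hid : ∀ x : AtomExt i (rep α) Y, x = 0 := fun x => by
      obtain ⟨S, x, rfl⟩ := AtomExt.exists_mk x
      rw [← Abelian.Ext.comp_mk₀_id x, h0.eq_of_src (𝟙 Y) 0, Ext.mk₀_zero, Ext.comp_zero,
        AtomExt.mk_zero]
    obtain ⟨x, hx⟩ := exists_ne (0 : AtomExt i (rep α) Y)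
    exact hx (hid x)
  obtain ⟨G, j, hj⟩ := exists_monoform_of_noetherian m p hY0
  -- The conditions concern the fixed representative of the atom, not `G`; a common nonzero
  -- subobject `T` embeds in `Y`, and it suffices to work inside `T`.
  obtain ⟨L₁, L₂, h₁, h₂, ⟨e⟩⟩ := atom_eq_iff.1 (hrep G.atom)
  let T : NonzeroSub (rep G.atom) := ⟨L₁, h₁⟩
  let t : T.toObj ⟶ Y := e.hom ≫ L₂.arrow ≫ j
  have : Nontrivial (AtomExt i (rep α) T.toObj) :=
    (hsurj t (𝟙 Y) T.not_isZero).nontrivial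
  refine ⟨G.atom, ⟨⟨T, fun K₁ K₂ h' h => hsurj _ (NonzeroSub.incl h' ≫ t) K₂.not_isZero⟩,
    virtualDual_nontrivial T fun S hS => hsurj _ t S.not_isZero⟩, G, rfl, ?_⟩
  exact (IsSubquotient.of_mono j).trans (IsSubquotient.of_mono_of_epi m p)

theorem eventuallyConstant_zero_self (H : MonoformObj C) : EventuallyConstant 0 H H :=
  ⟨NonzeroSub.top H, fun _ _ _ h =>
    ⟨AtomExt.map_zero_injective _, AtomExt.map_zero_surjective h⟩⟩

theorem EventuallyConstant.eventuallyEpic {H K : MonoformObj C} (h : EventuallyConstant i H K) :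
    EventuallyEpic i H K :=
  let ⟨T, hT⟩ := h
  ⟨T, fun K₁ K₂ h₁ h₂ => (hT K₁ K₂ h₁ h₂).2⟩

theorem atom_eq_of_nontrivial_zero {H K : MonoformObj C} (S : NonzeroSub K)
    (h : Nontrivial (AtomExt 0 H S.toObj)) : K.atom = H.atom := by
  obtain ⟨W, f, hf⟩ := AtomExt.exists_mono_of_nontrivial h
  exact atom_eq_of_mono W.not_isZero (f ≫ S.sub.arrow) W.sub.arrow

theorem EpiSet_zero (hrep : ∀ α, (rep α).atom = α) : EpiSet rep 0 α = {α} := by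
  refine Set.eq_singleton_iff_unique_mem.2 ⟨⟨(eventuallyConstant_zero_self _).eventuallyEpic, ?_⟩,
    fun β hβ => ?_⟩
  · have := AtomExt.nontrivial_zero_sub (NonzeroSub.top (rep α))
    exact virtualDual_nontrivial (NonzeroSub.top (rep α)) fun S hS => AtomExt.map_zero_surjective hS
  · obtain ⟨S, -, hS⟩ := exists_nontrivial_of_virtualDual hβ.2 (NonzeroSub.top _)
    rw [← hrep β, ← hrep α]
    exact atom_eq_of_nontrivial_zero S hS

theorem ConstSet_zero (hrep : ∀ α, (rep α).atom = α) : ConstSet rep 0 α = {α} := by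
  refine Set.eq_singleton_iff_unique_mem.2 ⟨⟨eventuallyConstant_zero_self _, ?_⟩,
    fun β hβ => ?_⟩
  · have := AtomExt.nontrivial_zero_sub (NonzeroSub.top (rep α))
    exact atomAtomExt_nontrivial (NonzeroSub.top (rep α)) fun _ _ _ h =>
      ⟨AtomExt.map_zero_injective _, AtomExt.map_zero_surjective h⟩
  · obtain ⟨S, hS⟩ := nontrivial_of_atomAtomExt hβ.2
    rw [← hrep β, ← hrep α]
    exact atom_eq_of_nontrivial_zero S hS

theorem EpiSet_succ_subset (hrep : ∀ α, (rep α).atom = α) {ι : Type v}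
    {U : ι → C} (hU : IsGeneratingSet U) (hN : ∀ s, IsNoetherianObject (U s)) :
    EpiSet rep (i + 1) α ⊆ ConstSet rep (i + 1) α ∪ derivedSet (EpiSet rep i α) := by
  rintro β ⟨⟨T, hT⟩, hV⟩
  refine or_iff_not_imp_right.2 fun hβ => ?_
  -- `β` may itself lie in `Epi_i(α)`: failing to be a limit point excludes only the other points.
  have hnhd : ∃ V : Set (AtomSpectrum C), IsOpen V ∧ β ∈ V ∧
      ∀ γ ∈ V, γ ∈ EpiSet rep i α → γ = β := by
    rw [mem_derivedSet, accPt_iff_nhds] at hβ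
    push Not at hβ
    obtain ⟨V, hV, h⟩ := hβ
    obtain ⟨V', hV', ho, hm⟩ := mem_nhds_iff.1 hV
    exact ⟨V', ho, hm, fun γ hγ hE => h γ ⟨hV' hγ, hE⟩⟩
  obtain ⟨V, ho, hm, hE⟩ := hnhd
  rw [← hrep β] at hm
  obtain ⟨S, hS⟩ := exists_ASupp_subset_of_mem_open ho hm
  obtain ⟨Y, m, hmono, hYn, hY0⟩ := exists_noetherian_mono hU hN S.not_isZero
  let R : NonzeroSub (rep β) := ⟨Subobject.mk (m ≫ S.sub.arrow), subobject_mk_ne_bot _ hY0⟩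
  have hSR : S ≤ R := Subobject.mk_le_of_comm m rfl
  obtain ⟨W, hRW, hTW⟩ := exists_ge_ge R T
  have hbij : ∀ (K₁ K₂ : NonzeroSub (rep β)) (_ : W ≤ K₁) (h : K₁ ≤ K₂),
      Function.Bijective (AtomExt.map (i + 1) (rep α) (NonzeroSub.incl h)) := by
    intro K₁ K₂ h₁ h
    -- Surjectivity is the eventual epicness of `β`; only injectivity needs `Ext^i(α, K₁/K₂) = 0`.
    refine ⟨AtomExt.map_injective_of_mono _ (not_nontrivial_iff_subsingleton.1 fun hn => ?_),
      hT K₁ K₂ (hTW.trans h₁) h⟩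
    let f : K₁.toObj ⟶ Y :=
      NonzeroSub.incl (hRW.trans h₁) ≫ (Subobject.underlyingIso (m ≫ S.sub.arrow)).hom
    have hf : Mono f := mono_comp _ _
    have : IsNoetherianObject K₁.toObj := isNoetherianObject_of_mono f
    have : IsNoetherianObject (cokernel (NonzeroSub.incl h)) :=
      IsNoetherianObject.of_epi (cokernel.π _)
    obtain ⟨γ, hγ, hs⟩ := exists_mem_EpiSet hrep hn
    have hsub : ASupp (cokernel (NonzeroSub.incl h)) ⊆ V :=
      (ASupp_subset (IsSubquotient.of_mono_of_epi
        (NonzeroSub.incl ((hSR.trans hRW).trans h₁)) (cokernel.π _))).trans hS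
    rw [(hE γ (hsub hs) hγ).trans (hrep β).symm] at hs
    exact atom_notMem_ASupp_cokernel (NonzeroSub.incl h) K₁.sub.arrow K₂.not_isZero hs
  -- The nonzero group must be found inside `W`, where the system is already constant.
  obtain ⟨Q, hQ, _⟩ := exists_nontrivial_of_virtualDual hV W
  exact ⟨⟨W, hbij⟩, atomAtomExt_nontrivial Q fun S S' h h' => hbij S S' (hQ.trans h) h'⟩

theorem EpiSet_subset_iUnion (hrep : ∀ α, (rep α).atom = α) {ι : Type v}
    {U : ι → C} (hU : IsGeneratingSet U) (hN : ∀ s, IsNoetherianObject (U s)) (i : ℕ) :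
    EpiSet rep i α ⊆
      ⋃ j ∈ Finset.range (i + 1), derivedSet^[j] (ConstSet rep (i - j) α) := by
  induction i with
  | zero => simp [EpiSet_zero hrep, ConstSet_zero hrep]
  | succ i ih =>
    -- Finiteness of the union matters: limit points of an infinite union need not be limit points
    -- of a member.
    have hfin : ∀ (s : Finset ℕ) (f : ℕ → Set (AtomSpectrum C)),
        derivedSet (⋃ j ∈ s, f j) ⊆ ⋃ j ∈ s, derivedSet (f j) := by
      intro s f
      classical
      induction s using Finset.induction_on with
      | empty => simp [derivedSet, AccPt, Filter.neBot_iff]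
      | insert a s _ h =>
        simp only [Finset.set_biUnion_insert, derivedSet_union]
        exact Set.union_subset_union_right _ h
    refine (EpiSet_succ_subset hrep hU hN).trans (Set.union_subset ?_ ?_)
    · exact Set.subset_biUnion_of_mem (u := fun j => derivedSet^[j] (ConstSet rep (i + 1 - j) α))
        (Finset.mem_coe.2 (Finset.mem_range.2 (Nat.succ_pos _)))
    · refine (derivedSet_mono _ _ ih).trans ((hfin _ _).trans ?_)
      refine Set.iUnion₂_subset fun j hj => ?_
      -- The `j`-th term in degree `i` becomes the `(j + 1)`-st in degree `i + 1`, as `i - j = (i +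
      -- 1) - (j + 1)`.
      rw [← Function.iterate_succ_apply' derivedSet j, ← Nat.add_sub_add_right i 1 j]
      exact Set.subset_biUnion_of_mem (u := fun j => derivedSet^[j] (ConstSet rep (i + 1 - j) α))
        (Finset.mem_coe.2 (Finset.mem_range.2 (by have := Finset.mem_range.1 hj; omega)))

end Main

end Ext

end AtomTheory

end

theorem theorem5 {A : Type u} [Category.{v} A] [Abelian A] [HasExt.{w} A]
    {ι : Type v} (U : ι → A) (hU : AtomTheory.IsGeneratingSet U)
    (hN : ∀ i, IsNoetherianObject (U i))
    (rep : AtomTheory.AtomSpectrum A → AtomTheory.MonoformObj A)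
    (hrep : ∀ α, (rep α).atom = α)
    (α : AtomTheory.AtomSpectrum A) :
    (AtomTheory.EpiSet rep 0 α = {α} ∧ AtomTheory.ConstSet rep 0 α = {α}) ∧
    (∀ i : ℕ, 1 ≤ i → AtomTheory.EpiSet rep i α ⊆
      AtomTheory.ConstSet rep i α ∪ derivedSet (AtomTheory.EpiSet rep (i - 1) α)) ∧
    (∀ i : ℕ, AtomTheory.EpiSet rep i α ⊆
      ⋃ j ∈ Finset.range (i + 1), derivedSet^[j] (AtomTheory.ConstSet rep (i - j) α)) := by
  refine ⟨⟨AtomTheory.EpiSet_zero hrep, AtomTheory.ConstSet_zero hrep⟩, fun i hi => ?_,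
    AtomTheory.EpiSet_subset_iUnion hrep hU hN⟩
  obtain ⟨i, rfl⟩ := Nat.exists_eq_add_of_le' hi
  exact AtomTheory.EpiSet_succ_subset hrep hU hN
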